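/- **Setting.** Fix a finite relational signature with arities at most $l$. A *family ordering* on $\{1,\dots,k\}$, $k\le l$, is a union of disjoint rooted trees with vertex set $\{1,\dots,k\}$, given by its ancestor relation $<$ ($i<j$: $i$ is an ancestor of $j$; roots are the $<$-maximal elements); if it is a single tree, its root is $1$. A *family pattern* is a family ordering $F$ with a function $\delta$ assigning a number $\delta(j,i)\in\{1,\dots,l\}$ to each pair with $i<_F j$. Each relation symbol $Q$ of arity $k$ carries a family pattern $(F_Q,\delta_Q)$ on $\{1,\dots,k\}$, and the signature is the disjoint union of *parenthood predicates* and *projection predicates*. Let $\mathcal T$ be a set of joinless TGDs (no variable occurs twice in the body, and none occurs twice in the head) that *respects family patterns*, i.e.: 1. Each rule whose head is a projection predicate is a fact $\Rightarrow P()$ for a $0$-ary predicate, or a rule $R\Rightarrow P$ with $R=Q(\bar x)$, $P=Q'(\bar y)$, $\bar y\subseteq\bar x$, such that whenever $R(i)=P(j)$ and $R(i')=P(j')$ one has $i<_{F_Q}i'\iff j<_{F_{Q'}}j'$, and $\delta_Q(i',i)=\delta_{Q'}(j',j)$ if $i<_{F_Q}i'$. (Here $R(i)$ is the $i$-th argument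 of $R$.) 2. Each rule whose head is a parenthood predicate has the form $R_1\wedge\dots\wedge R_m\Rightarrow\exists z\,P$ with $m\ge 0$, $R_s=Q_s(\bar x_s)$, $P=S(z,\bar x_1,\dots,\bar x_m)$, $z$ not in the body, where $i<_{F_S}j$ holds iff either $j=1$ and $i\neq1$, or for some $s$ the variables $P(i),P(j)$ occur in $R_s$ at positions $i',j'$ with $i'<_{F_{Q_s}}j'$; in the first case $\delta_S(1,i)=i$, in the second $\delta_S(j,i)=\delta_{Q_s}(j',i')$. 3. For each projection predicate $Q$ there is a parenthood predicate $Q'$ such that $Q(\bar t)\Rightarrow\exists t\,Q'(t,\bar t)$ and $Q'(t,\bar t)\Rightarrow Q(\bar t)$ are rules of $\mathcal T$. Let $Chase=\bigcup_i Chase^i$ be the chase of the empty database: $Chase^0=\emptyset$, and $Chase^{i+1}$ adds to $Chase^i$, for each rule and each substitution that makes its body true and its head not satisfied in $Chase^i$, the corresponding instance of the head, with a new constant as witness for the existential quantifier (if there is one); the constant depends only on the head predicate and the values of the other variables in the head. Each element $a$ of $Chase$ occurs as the first argument of exactly one true atom $PP(a,\bar a)$ of a parenthood predicate, its *Parenthood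 Atom*; the elements of $\bar a$ are the *parents* of $a$. Two parents of $a$ and $b$ are *respective* if they stand in the same position of the Parenthood Atoms. Let $H^1(a)$ be the set of parents of $a$ and $H^{k+1}(a)=\{a\}\cup\bigcup_{b\in H^1(a)}H^k(b)$. For $k\ge1$, the *$k$-coloring* gives each element $a$ the smallest color (natural number) not used by the elements of $H^k(a)\setminus\{a\}$. Let $\mathrm{type}^k_0(a)$ be the $k$-color of $a$, and let $\mathrm{type}^k_{n+1}(a)$ consist of the $k$-color of $a$ and the tuple of the $\mathrm{type}^k_n$ of the parents of $a$. Define $a\equiv_0b$ iff the Parenthood Atoms of $a$ and $b$ have the same predicate, and $a\equiv_{n+1}b$ iff $\mathrm{type}^{n+1}_{n+1}(a)=\mathrm{type}^{n+1}_{n+1}(b)$, their Parenthood Atoms have the same predicate, $a\equiv_nb$, and all respective parents of $a$ and $b$ are $n$-equivalent. Let $M_n=Chase/{\equiv_n}$, with the smallest relations for which the quotient map is a homomorphism. **Theorem.** If a (Boolean) conjunctive query $\varphi$ is true in $M_n$ for every $n\in\mathbb N$, then $Chase\models\varphi$. -/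

import Mathlib

/-! ### Family orderings and family patterns

Positions in an atom of arity `k` are the elements of `Fin k`; the first position is `0`. -/

/-- A family ordering on `k` positions: a union of disjoint trees, given by its ancestor relation
(`lt i j` says that `i` is an ancestor of `j`; roots are the youngest members, so they are the
maximal elements). A finite strict order is a union of such trees iff the elements above any given
element form a chain. It is one tree iff it has a greatest element, which then has to be the first
position. -/
structure FamilyOrdering (k : ℕ) where
  lt : Fin k → Fin k → Prop
  irrefl : ∀ i, ¬ lt i i
  trans : ∀ i j m, lt i j → lt j m → lt i m
  forest : ∀ i j j', lt i j → lt i j' → j = j' ∨ lt j j' ∨ lt j' j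
  root : ∀ r : Fin k, (∀ i, i ≠ r → lt i r) → r.val = 0

/-- A family pattern: a family ordering with at most `l` members, and an addressing function:
`addr j i` is how `j` addresses its ancestor `i`. Only the values with `lt i j` matter. -/
structure FamilyPattern (l k : ℕ) extends FamilyOrdering k where
  card_le : k ≤ l
  addr : Fin k → Fin k → Fin l

/-- A relational signature in which every relation symbol carries a family pattern as part of its
name, and which is split into parenthood predicates and projection predicates (those symbols that
are not parenthood predicates). `l` bounds the arities. -/
structure Signature where
  Pred : Type
  l : ℕ
  arity : Pred → ℕ
  pattern : ∀ Q : Pred, FamilyPattern l (arity Q)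
  IsParenthood : Pred → Prop

/-! ### Atoms, relational structures, conjunctive queries -/

/-- An atom over the set `X` (of variables, or of elements of a structure). -/
structure Atom (σ : Signature) (X : Type) where
  pred : σ.Pred
  args : Fin (σ.arity pred) → X

/-- Applying a map to all arguments of an atom. -/
def Atom.map {σ : Signature} {X Y : Type} (f : X → Y) (A : Atom σ X) : Atom σ Y :=
  ⟨A.pred, fun p => f (A.args p)⟩

/-- The tuple of arguments of an atom, as a list. -/
def Atom.argList {σ : Signature} {X : Type} (A : Atom σ X) : List X := List.ofFn A.args

/-- The ancestor relation between the positions of an atom. -/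
def Atom.lt {σ : Signature} {X : Type} (A : Atom σ X) (i j : Fin (σ.arity A.pred)) : Prop :=
  (σ.pattern A.pred).lt i j

/-- How position `j` of an atom addresses position `i`. -/
def Atom.addr {σ : Signature} {X : Type} (A : Atom σ X) (j i : Fin (σ.arity A.pred)) : Fin σ.l :=
  (σ.pattern A.pred).addr j i

/-- A relational structure: a domain and the set of atoms that are true. -/
structure RelStructure (σ : Signature) where
  Dom : Type
  facts : Set (Atom σ Dom)

/-- A (Boolean) conjunctive query: all `numVars` variables are existentially quantified. -/
structure CQ (σ : Signature) where
  numVars : ℕ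
  atoms : List (Atom σ (Fin numVars))

/-- Truth of a conjunctive query in a structure. -/
def RelStructure.Models {σ : Signature} (M : RelStructure σ) (φ : CQ σ) : Prop :=
  ∃ v : Fin φ.numVars → M.Dom, ∀ A ∈ φ.atoms, A.map v ∈ M.facts

/-! ### Tuple generating dependencies -/

/-- A tuple generating dependency: a conjunction of atoms implies the head atom. Variables of the
head that do not occur in the body are existentially quantified; such a variable may only occur
in the first position of the head, i.e. the rule is `Φ(x̄) ⇒ ∃ y Q(y, ȳ)` or `Φ(x̄) ⇒ Q(ȳ)` with
`ȳ ⊆ x̄`. -/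
structure TGD (σ : Signature) where
  body : List (Atom σ ℕ)
  head : Atom σ ℕ
  frontier : ∀ p, p.val ≠ 0 → head.args p ∈ body.flatMap Atom.argList

/-- The list of all occurrences of variables in the body. -/
def TGD.bodyVars {σ : Signature} (τ : TGD σ) : List ℕ := τ.body.flatMap Atom.argList

/-- No variable occurs twice in the body, and no variable occurs twice in the head. -/
def TGD.Joinless {σ : Signature} (τ : TGD σ) : Prop :=
  τ.bodyVars.Nodup ∧ τ.head.argList.Nodup

/-- A rule `R ⇒ P` with `Var(P) ⊆ Var(R)` (or a fact, with empty body and hence without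
arguments), where the head inherits from the body the ancestor relation and the way in which
ancestors are addressed. -/
def TGD.IsProjectionRule {σ : Signature} (τ : TGD σ) : Prop :=
  τ.body.length ≤ 1 ∧
  (∀ p, τ.head.args p ∈ τ.bodyVars) ∧
  ∀ R ∈ τ.body, ∀ i i' p p', R.args i = τ.head.args p → R.args i' = τ.head.args p' →
    (R.lt i i' ↔ τ.head.lt p p') ∧ (R.lt i i' → R.addr i' i = τ.head.addr p' p)

/-- A rule `R₁(x̄₁) ∧ … ∧ R_m(x̄_m) ⇒ ∃ z P(z, x̄₁, …, x̄_m)`, where in the head everybody else is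
an ancestor of the child `z`, who addresses them by their positions in `P`, and the other
relations are inherited from the atoms of the body. -/
def TGD.IsParenthoodRule {σ : Signature} (τ : TGD σ) : Prop :=
  (∃ z, z ∉ τ.bodyVars ∧ τ.head.argList = z :: τ.bodyVars) ∧
  (∀ p q, τ.head.lt p q ↔ (q.val = 0 ∧ p.val ≠ 0) ∨
    ∃ R ∈ τ.body, ∃ i j, R.args i = τ.head.args p ∧ R.args j = τ.head.args q ∧ R.lt i j) ∧
  (∀ p q, q.val = 0 → p.val ≠ 0 → (τ.head.addr q p).val = p.val) ∧
  ∀ R ∈ τ.body, ∀ i j p q, R.args i = τ.head.args p → R.args j = τ.head.args q → R.lt i j →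
    τ.head.addr q p = R.addr j i

/-- The set `T` of rules respects family patterns. -/
structure RespectsFamilyPatterns {σ : Signature} (T : Set (TGD σ)) : Prop where
  /-- The heads of projection rules are projection predicates, the heads of rules that create new
  elements are parenthood predicates, and there are no other rules. -/
  shape : ∀ τ ∈ T, (¬ σ.IsParenthood τ.head.pred ∧ τ.IsProjectionRule) ∨
    (σ.IsParenthood τ.head.pred ∧ τ.IsParenthoodRule)
  /-- For each projection predicate `Q` there is a parenthood predicate `Q'` such that the rules
  `Q(t̄) ⇒ ∃ t Q'(t, t̄)` and `Q'(t, t̄) ⇒ Q(t̄)` belong to `T`. -/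
  adult : ∀ Q, ¬ σ.IsParenthood Q → ∃ Q', σ.IsParenthood Q' ∧
    (∃ τ ∈ T, ∃ R t, τ.body = [R] ∧ R.pred = Q ∧ τ.head.pred = Q' ∧
      τ.head.argList = t :: R.argList) ∧
    (∃ τ ∈ T, ∃ R t, τ.body = [R] ∧ R.pred = Q' ∧ τ.head.pred = Q ∧
      R.argList = t :: τ.head.argList)

/-! ### The chase of the empty database -/

/-- Names for the elements of the chase: `mk Q a` is the new constant that is added as a witness
for `∃ y Q(y, a)`. -/
inductive Elem (σ : Signature) : Type
  | mk (Q : σ.Pred) (parents : Fin (σ.arity Q - 1) → Elem σ) : Elem σ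

/-- The head of the rule is satisfied, in the set `S` of facts, for the substitution `s` for the
variables of the body. -/
def TGD.HeadSatisfied {σ : Signature} (τ : TGD σ) (S : Set (Atom σ (Elem σ)))
    (s : ℕ → Elem σ) : Prop :=
  ∃ s' : ℕ → Elem σ, (∀ x ∈ τ.bodyVars, s' x = s x) ∧ τ.head.map s' ∈ S

open Classical in
/-- The head of the rule for the substitution `s`, with the new constant as the value of the
existentially quantified variable, if there is one. -/
noncomputable def TGD.headInstance {σ : Signature} (τ : TGD σ) (s : ℕ → Elem σ) :
    Atom σ (Elem σ) :=
  ⟨τ.head.pred, fun p => if τ.head.args p ∈ τ.bodyVars then s (τ.head.args p) else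
    Elem.mk τ.head.pred fun i => s (τ.head.args ⟨i.val + 1, by have := i.isLt; omega⟩)⟩

/-- The stages of the chase: if the body of a rule is satisfied in the current stage, and the head
is not, then the head is added, with a new constant as a witness for the existential quantifier.
The constant `Elem.mk Q a` is indeed new: it only ever appears together with the fact
`Q(Elem.mk Q a, a)`, which makes the head satisfied. -/
def chaseStage {σ : Signature} (T : Set (TGD σ)) : ℕ → Set (Atom σ (Elem σ))
  | 0 => ∅
  | n + 1 => chaseStage T n ∪ {A | ∃ τ ∈ T, ∃ s : ℕ → Elem σ,
      (∀ B ∈ τ.body, B.map s ∈ chaseStage T n) ∧ ¬ τ.HeadSatisfied (chaseStage T n) s ∧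
      A = τ.headInstance s}

/-- The facts of the chase. -/
def chaseFacts {σ : Signature} (T : Set (TGD σ)) : Set (Atom σ (Elem σ)) :=
  ⋃ n, chaseStage T n

/-- The elements of the chase: those that occur in a fact. -/
def chaseDom {σ : Signature} (T : Set (TGD σ)) : Set (Elem σ) :=
  {a | ∃ A ∈ chaseFacts T, ∃ p, A.args p = a}

/-- The chase as a relational structure. -/
def chase {σ : Signature} (T : Set (TGD σ)) : RelStructure σ where
  Dom := chaseDom T
  facts := {A | A.map Subtype.val ∈ chaseFacts T}

/-! ### Parents, histories, colorings and types -/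

/-- The predicate of the Parenthood Atom of an element. -/
def Elem.parenthoodPred {σ : Signature} : Elem σ → σ.Pred
  | .mk Q _ => Q

/-- The tuple of parents of an element. -/
def Elem.parents {σ : Signature} : (a : Elem σ) → Fin (σ.arity a.parenthoodPred - 1) → Elem σ
  | .mk _ v => v

/-- The Parenthood Atom `Q(a, ā)` of `a`, where `ā` is the tuple of parents of `a`. -/
def Elem.parenthoodAtom {σ : Signature} (a : Elem σ) : Atom σ (Elem σ) :=
  ⟨a.parenthoodPred, fun p => if h : p.val = 0 then a else
    a.parents ⟨p.val - 1, by have := p.isLt; omega⟩⟩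

theorem headInstance_parenthood {σ : Signature} (τ : TGD σ) (h : τ.IsParenthoodRule)
    (s : ℕ → Elem σ) : ∃ v, τ.headInstance s = (Elem.mk τ.head.pred v).parenthoodAtom := by
  obtain ⟨⟨z, hz, hl⟩, -⟩ := h
  refine ⟨fun i => s (τ.head.args ⟨i.val + 1, by have := i.isLt; omega⟩), ?_⟩
  unfold TGD.headInstance Elem.parenthoodAtom
  simp only [Elem.parenthoodPred, Elem.parents, Atom.mk.injEq, heq_eq_eq, true_and]
  funext p
  by_cases hp : p.val = 0
  · have : τ.head.args p = z := by
      have h0 : τ.head.argList[p.val]'(by simp [Atom.argList]) = τ.head.args p := by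
        simp [Atom.argList]
      rw [← h0]; simp [hl, hp]
    simp [hp, this, hz]
  · have : τ.head.args p ∈ τ.bodyVars := τ.frontier p hp
    simp only [this, hp, if_true, dif_neg, not_false_eq_true]
    congr 2
    apply Fin.ext; simp; omega

theorem stage_spec {σ : Signature} {T : Set (TGD σ)} (hF : RespectsFamilyPatterns T) (n : ℕ) : ∀ A ∈ chaseStage T n,
    (σ.IsParenthood A.pred → ∃ a : Elem σ, A = a.parenthoodAtom) ∧
    ∀ p, (A.args p).parenthoodAtom ∈ chaseStage T n ∧ σ.IsParenthood (A.args p).parenthoodPred ∧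
      0 < σ.arity (A.args p).parenthoodPred := by
  induction n with
  | zero => intro A hA; exact absurd hA (by simp [chaseStage])
  | succ n ih =>
    intro A hA
    rcases hA with hA | ⟨τ, hτ, s, hb, hns, rfl⟩
    · exact ⟨(ih A hA).1, fun p => ⟨Or.inl ((ih A hA).2 p).1, ((ih A hA).2 p).2⟩⟩
    · have key : ∀ x ∈ τ.bodyVars, (s x).parenthoodAtom ∈ chaseStage T n ∧
          σ.IsParenthood (s x).parenthoodPred ∧ 0 < σ.arity (s x).parenthoodPred := by
        intro x hx
        simp only [TGD.bodyVars, List.mem_flatMap, Atom.argList, List.mem_ofFn] at hx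
        obtain ⟨B, hB, p, rfl⟩ := hx
        exact (ih _ (hb B hB)).2 p
      have hmem : τ.headInstance s ∈ chaseStage T (n+1) := Or.inr ⟨τ, hτ, s, hb, hns, rfl⟩
      rcases hF.shape τ hτ with ⟨hP, h⟩ | ⟨hP, h⟩
      · refine ⟨fun hh => absurd hh hP, fun p => ?_⟩
        have : (τ.headInstance s).args p = s (τ.head.args p) := by
          simp only [TGD.headInstance]; rw [if_pos (h.2.1 p)]
        rw [this]
        exact ⟨Or.inl (key _ (h.2.1 p)).1, (key _ (h.2.1 p)).2⟩
      · obtain ⟨v, hv⟩ := headInstance_parenthood τ h s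
        refine ⟨fun _ => ⟨_, hv⟩, fun p => ?_⟩
        by_cases hp : τ.head.args p ∈ τ.bodyVars
        · have : (τ.headInstance s).args p = s (τ.head.args p) := by
            simp only [TGD.headInstance]; rw [if_pos hp]
          rw [this]
          exact ⟨Or.inl (key _ hp).1, (key _ hp).2⟩
        · have hp0 : p.val = 0 := by
            by_contra h0; exact hp (τ.frontier p h0)
          have e : ∀ (A : Atom σ (Elem σ)) (e : A = (Elem.mk τ.head.pred v).parenthoodAtom)
             (p : Fin (σ.arity A.pred)), p.val = 0 → A.args p = Elem.mk τ.head.pred v := by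
            rintro _ rfl p hp; simp [Elem.parenthoodAtom, hp]
          rw [e _ hv p hp0, ← hv]
          refine ⟨hmem, hP, ?_⟩
          obtain ⟨⟨z, -, hl⟩, -⟩ := h
          have := congrArg List.length hl
          simp only [Atom.argList, List.length_ofFn, List.length_cons] at this
          simp only [Elem.parenthoodPred]
          omega

/-- Each element `a` of the chase has exactly one Parenthood Atom (a true atom of a parenthood
predicate with `a` in the first position), and it is the one defined above. -/
theorem parenthoodAtom_unique {σ : Signature} {T : Set (TGD σ)} (hF : RespectsFamilyPatterns T) (a : Elem σ) (ha : a ∈ chaseDom T)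
    (A : Atom σ (Elem σ)) :
    (A ∈ chaseFacts T ∧ σ.IsParenthood A.pred ∧ ∃ p, p.val = 0 ∧ A.args p = a) ↔
      A = a.parenthoodAtom := by
  constructor
  · rintro ⟨hA, hP, p, hp, rfl⟩
    obtain ⟨n, hA⟩ := Set.mem_iUnion.1 hA
    obtain ⟨b, rfl⟩ := (stage_spec hF n A hA).1 hP
    congr 1; simp [Elem.parenthoodAtom, hp]
  · rintro rfl
    obtain ⟨B, hB, p, rfl⟩ := ha
    obtain ⟨n, hB⟩ := Set.mem_iUnion.1 hB
    obtain ⟨h1, h2, h0⟩ := (stage_spec hF n B hB).2 p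
    refine ⟨Set.mem_iUnion.2 ⟨n, h1⟩, h2, ?_⟩
    exact ⟨⟨0, h0⟩, rfl, by simp [Elem.parenthoodAtom]⟩

/-- `b` is a parent of `a`. -/
def IsParent {σ : Signature} (b a : Elem σ) : Prop := ∃ i, a.parents i = b

theorem isParent_wf {σ : Signature} : WellFounded (IsParent (σ := σ)) := by
  refine ⟨fun a => ?_⟩
  induction a with
  | mk Q v ih =>
    refine ⟨_, fun b hb => ?_⟩
    obtain ⟨i, rfl⟩ := hb
    exact ih i

/-- The `n`-history of an element (for `n ≥ 1`; the value at `0` plays no role): the `1`-history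
is the set of parents, and `H^{n+1}(a)` is `{a}` together with the `n`-histories of the parents. -/
def history {σ : Signature} : ℕ → Elem σ → Set (Elem σ)
  | 0, _ => ∅
  | 1, a => {b | IsParent b a}
  | n + 2, a => {a} ∪ ⋃ b ∈ {b | IsParent b a}, history (n + 1) b

theorem history_subset {σ : Signature} (n : ℕ) (a b : Elem σ) (hb : b ∈ history n a)
    (hne : b ≠ a) : Relation.TransGen IsParent b a := by
  match n with
  | 0 => exact absurd hb (by simp [history])
  | 1 => exact .single hb
  | n + 2 =>
    simp only [history, Set.mem_union, Set.mem_singleton_iff, Set.mem_iUnion] at hb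
    rcases hb with h | ⟨c, hc, h⟩
    · exact absurd h hne
    · by_cases hbc : b = c
      · subst hbc; exact .single hc
      · exact (history_subset (n + 1) c b h hbc).tail hc

/-- The `k`-coloring, with the natural numbers as colors: each element gets the smallest color
that is not used by the (other) elements of its `k`-history. -/
noncomputable def color {σ : Signature} (k : ℕ) : Elem σ → ℕ :=
  isParent_wf.transGen.fix fun a rec =>
    sInf {c | ∀ (b : Elem σ) (hb : b ∈ history k a) (hne : b ≠ a),
      rec b (history_subset k a b hb hne) ≠ c}

theorem color_eq {σ : Signature} (k : ℕ) (a : Elem σ) :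
    color k a = sInf {c | ∀ b ∈ history k a, b ≠ a → color k b ≠ c} :=
  isParent_wf.transGen.fix_eq _ a

/-- Values for the types of elements: a color with a tuple of types. -/
inductive ElemType : Type
  | node (c : ℕ) (ts : List ElemType) : ElemType

/-- `elemType k n a` is the type `type_n^k` of `a`: `type_0^k` is the `k`-color, and
`type_{n+1}^k` is the `k`-color together with the tuple of the `type_n^k` of the parents. -/
noncomputable def elemType {σ : Signature} (k : ℕ) : ℕ → Elem σ → ElemType
  | 0, a => .node (color k a) []
  | n + 1, a => .node (color k a) (List.ofFn fun i => elemType k n (a.parents i))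

/-! ### The structures `M_n` -/

/-- `n`-equivalence of elements. -/
def NEquiv {σ : Signature} : ℕ → Elem σ → Elem σ → Prop
  | 0, a, b => a.parenthoodPred = b.parenthoodPred
  | n + 1, a, b => elemType (n + 1) (n + 1) a = elemType (n + 1) (n + 1) b ∧
      a.parenthoodPred = b.parenthoodPred ∧ NEquiv n a b ∧
      ∀ i j, i.val = j.val → NEquiv n (a.parents i) (b.parents j)

theorem nEquiv_equivalence {σ : Signature} (n : ℕ) : Equivalence (NEquiv (σ := σ) n) := by
  induction n with
  | zero => exact ⟨fun _ => rfl, fun h => h.symm, fun h h' => h.trans h'⟩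
  | succ n ih =>
    refine ⟨fun a => ⟨rfl, rfl, ih.refl a, fun i j h => ?_⟩, fun h => ⟨h.1.symm, h.2.1.symm,
      ih.symm h.2.2.1, fun i j hij => ih.symm (h.2.2.2 j i hij.symm)⟩, fun {a b c} h h' =>
      ⟨h.1.trans h'.1, h.2.1.trans h'.2.1, ih.trans h.2.2.1 h'.2.2.1, fun i j hij => ?_⟩⟩
    · rw [Fin.ext h]; exact ih.refl _
    · have hi : i.val < σ.arity b.parenthoodPred - 1 := h.2.1 ▸ i.isLt
      exact ih.trans (h.2.2.2 i ⟨i.val, hi⟩ rfl) (h'.2.2.2 ⟨i.val, hi⟩ j hij)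

/-- `n`-equivalence on the elements of the chase. -/
def nSetoid {σ : Signature} (T : Set (TGD σ)) (n : ℕ) : Setoid (chase T).Dom where
  r a b := NEquiv n a.val b.val
  iseqv := (nEquiv_equivalence n).comap Subtype.val

/-- The structure `M_n`: the quotient of the chase by `n`-equivalence, with the smallest relations
for which the quotient map is a homomorphism. -/
def quotientModel {σ : Signature} (T : Set (TGD σ)) (n : ℕ) : RelStructure σ where
  Dom := Quotient (nSetoid T n)
  facts := (Atom.map (Quotient.mk (nSetoid T n))) '' (chase T).facts

/-- A query is M-true if it is true in all the structures `M_n`. -/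
def MTrue {σ : Signature} (T : Set (TGD σ)) (φ : CQ σ) : Prop :=
  ∀ n, (quotientModel T n).Models φ

/-! Witnesses for φ in all the `M_n` give, for each variable, a sequence of elements of the chase.
Fix a nonprincipal ultrafilter on ℕ and identify two sequences if, for every m, almost all of their
members are m-equivalent. Such limits have a predicate (there are finitely many) and parents, and an
atom of φ, although true in each `M_n` only up to n-equivalence, is a limit of true atoms of the
chase.

Two facts bring the limits back to the chase. First, parenthood has no cycles among them
(`LimitParent.irrefl`): a cycle would yield an element and a proper ancestor in its k-history, for a
fixed k, with the same k-color. Second, a true atom stays true, for some choice of the remaining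
arguments, when some of its arguments are replaced by elements with the same Parenthood Predicates,
provided that ancestors among them are still the parents that the family pattern prescribes
(`exists_fact_with_args`). Joinlessness is what makes this replacement possible.

Hence the finitely many limits that occur in φ can be mapped to the chase by recursion along
parenthood, preserving predicates and those parents that are themselves in the set
(`exists_map_of_limit`). One more replacement shows that this map satisfies every atom of φ. -/

variable {σ : Signature}

/-! ### Parenthood Atoms and closure of the chase under the rules -/

theorem TGD.mem_bodyVars {τ : TGD σ} {x : ℕ} :
    x ∈ τ.bodyVars ↔ ∃ R ∈ τ.body, ∃ i, R.args i = x := by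
  simp [TGD.bodyVars, Atom.argList, List.mem_flatMap, List.mem_ofFn]

/-- The argument of the Parenthood Atom of `a` at position `k`. -/
def Elem.arg (a : Elem σ) (k : ℕ) : Elem σ :=
  -- Indexing by ℕ avoids casts between arities; out of range the value is `a` itself.
  if k = 0 then a else
    if h : k - 1 < σ.arity a.parenthoodPred - 1 then a.parents ⟨k - 1, h⟩ else a

theorem Elem.parenthoodAtom_args (a : Elem σ) (p : Fin (σ.arity a.parenthoodPred)) :
    a.parenthoodAtom.args p = a.arg p.val := by
  have := p.isLt
  by_cases hp : p.val = 0
  · simp [Elem.parenthoodAtom, Elem.arg, hp]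
  · have h : p.val - 1 < σ.arity a.parenthoodPred - 1 := by omega
    simp [Elem.parenthoodAtom, Elem.arg, hp, h]

theorem Elem.parenthoodAtom_eq (a : Elem σ) {Q : σ.Pred} (h : a.parenthoodPred = Q) :
    a.parenthoodAtom = ⟨Q, fun p => a.arg p.val⟩ := by
  subst h
  exact congrArg (Atom.mk a.parenthoodPred) (funext a.parenthoodAtom_args)

theorem Elem.isParent_arg (a : Elem σ) {k : ℕ} (h0 : 0 < k)
    (hk : k < σ.arity a.parenthoodPred) : IsParent (a.arg k) a := by
  have h : k - 1 < σ.arity a.parenthoodPred - 1 := by omega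
  exact ⟨⟨k - 1, h⟩, by simp [Elem.arg, h0.ne', h]⟩

variable {T : Set (TGD σ)}

theorem chaseStage_mono : Monotone (chaseStage T) :=
  monotone_nat_of_le_succ fun _ => Set.subset_union_left

theorem exists_stage_of_forall_mem_chaseFacts (l : List (Atom σ (Elem σ)))
    (h : ∀ A ∈ l, A ∈ chaseFacts T) : ∃ n, ∀ A ∈ l, A ∈ chaseStage T n := by
  induction l with
  | nil => exact ⟨0, by simp⟩
  | cons B l ih =>
    obtain ⟨n, hn⟩ := ih fun A hA => h A (by simp [hA])
    obtain ⟨m, hm⟩ := Set.mem_iUnion.1 (h B (by simp))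
    refine ⟨max m n, fun A hA => ?_⟩
    rcases List.mem_cons.1 hA with rfl | hA
    · exact chaseStage_mono (le_max_left _ _) hm
    · exact chaseStage_mono (le_max_right _ _) (hn A hA)

/-- The chase is a model of the rules. -/
theorem chaseFacts_closed {τ : TGD σ} (hτ : τ ∈ T) (s : ℕ → Elem σ)
    (h : ∀ B ∈ τ.body, B.map s ∈ chaseFacts T) :
    τ.HeadSatisfied (chaseFacts T) s := by
  classical
  obtain ⟨n, hn⟩ := exists_stage_of_forall_mem_chaseFacts (τ.body.map (Atom.map s))
    (by simpa using h)
  by_cases hs : τ.HeadSatisfied (chaseStage T n) s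
  · obtain ⟨s', h1, h2⟩ := hs
    exact ⟨s', h1, Set.mem_iUnion.2 ⟨n, h2⟩⟩
  · refine ⟨fun x => if x ∈ τ.bodyVars then s x else Elem.mk τ.head.pred fun i =>
      s (τ.head.args ⟨i.val + 1, by have := i.isLt; omega⟩), fun x hx => by simp [hx], ?_⟩
    refine Set.mem_iUnion.2 ⟨n + 1, Or.inr ⟨τ, hτ, s, ?_, hs, ?_⟩⟩
    · simpa using hn
    · simp [TGD.headInstance, Atom.map]

theorem TGD.headInstance_args {τ : TGD σ} (s : ℕ → Elem σ) (p : Fin (σ.arity τ.head.pred))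
    (hp : τ.head.args p ∈ τ.bodyVars) : (τ.headInstance s).args p = s (τ.head.args p) := by
  simp [TGD.headInstance, hp]

theorem TGD.IsParenthoodRule.headInstance_args {τ : TGD σ} (h : τ.IsParenthoodRule)
    (s : ℕ → Elem σ) : ∃ b : Elem σ, b.parenthoodPred = τ.head.pred ∧
      ∀ p, (τ.headInstance s).args p = b.arg p.val := by
  obtain ⟨v, hv⟩ := headInstance_parenthood τ h s
  refine ⟨Elem.mk τ.head.pred v, rfl, fun p => ?_⟩
  rw [Elem.parenthoodAtom_eq (Q := τ.head.pred) _ rfl] at hv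
  generalize τ.headInstance s = A at hv p
  subst hv
  rfl

/-! ### Family patterns in true atoms and the replacement of arguments -/

/-- In a true atom, ancestors are parents, at the position given by the addressing function. -/
theorem args_eq_arg_addr (hF : RespectsFamilyPatterns T) (n : ℕ) : ∀ A ∈ chaseStage T n,
    ∀ p q, A.lt p q → A.args p = (A.args q).arg (A.addr q p).val ∧ 0 < (A.addr q p).val ∧
      (A.addr q p).val < σ.arity (A.args q).parenthoodPred := by
  induction n with
  | zero => intro A hA; exact absurd hA (by simp [chaseStage])
  | succ n ih =>
    intro A hA
    rcases hA with hA | ⟨τ, hτ, s, hb, -, rfl⟩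
    · exact ih A hA
    -- A relation inherited from one body atom, with its address, is settled by the induction
    -- hypothesis for that atom.
    have key : ∀ R ∈ τ.body, ∀ (p q : Fin (σ.arity τ.head.pred)) (i j), R.args i = τ.head.args p →
        R.args j = τ.head.args q → R.lt i j → τ.head.addr q p = R.addr j i →
        (τ.headInstance s).args p = ((τ.headInstance s).args q).arg (τ.head.addr q p).val ∧
        0 < (τ.head.addr q p).val ∧
        (τ.head.addr q p).val < σ.arity ((τ.headInstance s).args q).parenthoodPred := by
      intro R hR p q i j hi hj hlt ha
      rw [TGD.headInstance_args s p (TGD.mem_bodyVars.2 ⟨R, hR, i, hi⟩),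
        TGD.headInstance_args s q (TGD.mem_bodyVars.2 ⟨R, hR, j, hj⟩), ← hi, ← hj, ha]
      exact ih _ (hb R hR) i j hlt
    intro p q hlt
    rcases hF.shape τ hτ with ⟨-, h⟩ | ⟨-, h⟩
    · obtain ⟨R, hR, i, hi⟩ := TGD.mem_bodyVars.1 (h.2.1 p)
      obtain ⟨R', hR', j, hj⟩ := TGD.mem_bodyVars.1 (h.2.1 q)
      obtain rfl : R = R' := by
        have := h.1
        match hbody : τ.body, this, hR, hR' with
        | [B], _, h1, h2 => simp at h1 h2; rw [h1, h2]
      have h' := h.2.2 R hR i j p q hi hj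
      have hR'' := h'.1.2 hlt
      exact key R hR p q i j hi hj hR'' (h'.2 hR'').symm
    · rcases (h.2.1 p q).1 hlt with ⟨hq, hp⟩ | ⟨R, hR, i, j, hi, hj, hR'⟩
      · obtain ⟨b, hbp, hb⟩ := h.headInstance_args s
        have hadr : ((τ.headInstance s).addr q p).val = p.val := h.2.2.1 p q hq hp
        have h0 : b.arg 0 = b := by simp [Elem.arg]
        rw [hadr, hb p, hb q, hq, h0, hbp]
        exact ⟨rfl, Nat.pos_of_ne_zero hp, p.isLt⟩
      · exact key R hR p q i j hi hj hR' (h.2.2.2 R hR i j p q hi hj hR')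

/-- Tuples for the atoms of a joinless body come from one substitution. -/
theorem TGD.exists_subst {X : Type} [Inhabited X] {τ : TGD σ} (hτ : τ.bodyVars.Nodup)
    (b : ∀ R ∈ τ.body, Fin (σ.arity R.pred) → X) :
    ∃ s : ℕ → X, ∀ R (hR : R ∈ τ.body) i, s (R.args i) = b R hR i := by
  obtain ⟨h1, h2⟩ := List.nodup_flatMap.1 hτ
  have : ∀ x, ∃ y, ∀ R (hR : R ∈ τ.body) i, R.args i = x → y = b R hR i := by
    intro x
    by_cases h : ∃ R, ∃ _ : R ∈ τ.body, ∃ i, R.args i = x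
    · obtain ⟨R, hR, i, rfl⟩ := h
      refine ⟨b R hR i, fun R' hR' i' hi => ?_⟩
      obtain rfl : R' = R := by
        by_contra hne
        have : Std.Symm (Function.onFun List.Disjoint (Atom.argList (σ := σ) (X := ℕ))) :=
          ⟨fun _ _ h => List.Disjoint.symm h⟩
        have hd : List.Disjoint R'.argList R.argList := h2.forall hR' hR hne
        refine hd (a := R'.args i') ?_ ?_
        · simp [Atom.argList, List.mem_ofFn]
        · rw [hi]; simp [Atom.argList, List.mem_ofFn]
      rw [List.nodup_ofFn.1 (h1 R' hR) hi]
    · exact ⟨default, fun R hR i hi => absurd ⟨R, hR, i, hi⟩ h⟩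
  choose s hs using this
  exact ⟨s, fun R hR i => hs _ R hR i rfl⟩

/-- Some of the arguments of a true atom can be replaced by elements with the same Parenthood
Predicates, as long as ancestors among them remain parents. -/
theorem exists_fact_with_args (hJ : ∀ τ ∈ T, τ.Joinless) (hF : RespectsFamilyPatterns T) (n : ℕ) :
    ∀ A ∈ chaseStage T n, ∀ (I : Set (Fin (σ.arity A.pred)))
      (c : Fin (σ.arity A.pred) → Elem σ),
      (∀ p ∈ I, (c p).parenthoodAtom ∈ chaseFacts T ∧
        (c p).parenthoodPred = (A.args p).parenthoodPred) →
      (∀ p ∈ I, ∀ q ∈ I, A.lt p q → c p = (c q).arg (A.addr q p).val) →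
      ∃ b : Fin (σ.arity A.pred) → Elem σ, ⟨A.pred, b⟩ ∈ chaseFacts T ∧ ∀ p ∈ I, b p = c p := by
  classical
  induction n with
  | zero => intro A hA; exact absurd hA (by simp [chaseStage])
  | succ n ih =>
    intro A hA
    rcases hA with hA | ⟨τ, hτ, s, hb, -, rfl⟩
    · exact ih A hA
    intro I c hc hlt
    -- If only body variables are prescribed, the replacement is pulled back to each body atom
    -- separately; the resulting atoms share one substitution by joinlessness, and the rule is
    -- applied again.
    by_cases hI : ∀ p ∈ I, τ.head.args p ∈ τ.bodyVars
    · have hinh : ∀ R ∈ τ.body, ∀ i j p q, R.args i = τ.head.args p → R.args j = τ.head.args q →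
          R.lt i j → τ.head.lt p q ∧ τ.head.addr q p = R.addr j i := by
        intro R hR i j p q hi hj hij
        rcases hF.shape τ hτ with ⟨-, h⟩ | ⟨-, h⟩
        · have := h.2.2 R hR i j p q hi hj
          exact ⟨this.1.1 hij, (this.2 hij).symm⟩
        · exact ⟨(h.2.1 p q).2 (.inr ⟨R, hR, i, j, hi, hj, hij⟩), h.2.2.2 R hR i j p q hi hj hij⟩
      -- No variable occurs twice in the head, so a prescription for positions is one for variables.
      obtain ⟨t, ht⟩ : ∃ t : ℕ → Elem σ, ∀ p ∈ I, t (τ.head.args p) = c p := by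
        have hinj : Function.Injective τ.head.args := List.nodup_ofFn.1 (hJ τ hτ).2
        exact ⟨Function.extend τ.head.args c s, fun p _ => hinj.extend_apply _ _ p⟩
      have hbody : ∀ R ∈ τ.body, ∃ b : Fin (σ.arity R.pred) → Elem σ,
          ⟨R.pred, b⟩ ∈ chaseFacts T ∧
          ∀ i, (∃ p ∈ I, R.args i = τ.head.args p) → b i = t (R.args i) := by
        intro R hR
        refine ih (R.map s) (hb R hR) {i | ∃ p ∈ I, R.args i = τ.head.args p}
          (fun i => t (R.args i)) ?_ ?_
        · rintro i ⟨p, hp, hi⟩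
          have h1 := hc p hp
          rw [TGD.headInstance_args s p (hI p hp)] at h1
          simp only [hi, ht p hp, Atom.map]
          exact h1
        · rintro i ⟨p, hp, hi⟩ j ⟨q, hq, hj⟩ hij
          have h1 := hinh R hR i j p q hi hj hij
          have h2 := hlt p hp q hq h1.1
          simp only [hi, hj, ht p hp, ht q hq]
          rw [h2]
          exact congrArg (fun x : Fin σ.l => (c q).arg x.val) h1.2
      choose b hb1 hb2 using hbody
      by_cases hne : Nonempty (Elem σ)
      · have : Inhabited (Elem σ) := Classical.inhabited_of_nonempty hne
        obtain ⟨s', hs'⟩ := TGD.exists_subst (hJ τ hτ).1 b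
        obtain ⟨u, hu1, hu2⟩ := chaseFacts_closed hτ s' (by
          intro R hR
          have : R.map s' = ⟨R.pred, b R hR⟩ := by
            simp only [Atom.map, Atom.mk.injEq, heq_eq_eq, true_and]
            exact funext fun i => hs' R hR i
          rw [this]; exact hb1 R hR)
        refine ⟨fun p => u (τ.head.args p), hu2, fun p hp => ?_⟩
        obtain ⟨R, hR, i, hi⟩ := TGD.mem_bodyVars.1 (hI p hp)
        simp only
        rw [hu1 _ (hI p hp), ← hi, hs' R hR i, hb2 R hR i ⟨p, hp, hi⟩, hi, ht p hp]
      · exact absurd ⟨s 0⟩ hne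
    -- Here the existential position `p` is prescribed. The Parenthood Atom of `c p` is the required
    -- fact: all other positions are ancestors of `p`, addressed by their own position, so `c p`
    -- determines their prescribed values.
    · push Not at hI
      obtain ⟨p, hp, hpb⟩ := hI
      rcases hF.shape τ hτ with ⟨-, h⟩ | ⟨-, h⟩
      · exact absurd (h.2.1 p) hpb
      have hp0 : p.val = 0 := by
        by_contra h0; exact hpb (τ.frontier p h0)
      obtain ⟨a, ha1, ha2⟩ := h.headInstance_args s
      have h0 : ∀ d : Elem σ, d.arg 0 = d := fun d => by simp [Elem.arg]
      have hpc := hc p hp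
      rw [ha2 p, hp0, h0, ha1, Elem.parenthoodAtom_eq (Q := τ.head.pred)] at hpc
      · refine ⟨fun q => (c p).arg q.val, hpc.1, fun q hq => ?_⟩
        by_cases hq0 : q.val = 0
        · obtain rfl : q = p := Fin.ext (hq0.trans hp0.symm)
          simp [hq0, h0]
        · rw [hlt q hq p hp ((h.2.1 q p).2 (.inl ⟨hp0, hq0⟩))]
          exact congrArg _ (h.2.2.1 q p hp0 hq0).symm
      · have := (hc p hp).2
        rwa [ha2 p, hp0, h0, ha1] at this

/-! ### Colors and n-equivalence -/

theorem history_finite (k : ℕ) (a : Elem σ) : (history k a).Finite := by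
  have hpar : ∀ a : Elem σ, {b | IsParent b a}.Finite := fun a => Set.finite_range a.parents
  induction k generalizing a with
  | zero => simp [history]
  | succ k ih =>
    match k with
    | 0 => exact hpar a
    | k + 1 => exact (Set.finite_singleton a).union ((hpar a).biUnion fun b _ => ih b)

/-- A history is finite, so some color is unused and the infimum defining the color is attained. -/
theorem color_ne {k : ℕ} {a b : Elem σ} (hb : b ∈ history k a) (hne : b ≠ a) :
    color k b ≠ color k a := by
  have hfin : (color k '' history k a).Finite := (history_finite k a).image _
  obtain ⟨c, hc⟩ := hfin.exists_notMem
  have hmem := Nat.sInf_mem (s := {c | ∀ b ∈ history k a, b ≠ a → color k b ≠ c})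
    ⟨c, fun b hb _ he => hc ⟨b, hb, he⟩⟩
  rw [color_eq k a]
  exact hmem b hb hne

theorem NEquiv.color_eq {k : ℕ} {a b : Elem σ} (h : NEquiv (k + 1) a b) :
    color (k + 1) a = color (k + 1) b := by
  have := h.1
  simp only [elemType, ElemType.node.injEq] at this
  exact this.1

theorem NEquiv.mono {m n : ℕ} (hmn : m ≤ n) {a b : Elem σ} (h : NEquiv n a b) : NEquiv m a b := by
  induction hmn with
  | refl => exact h
  | step _ ih => exact ih h.2.2.1

theorem NEquiv.parenthoodPred_eq {n : ℕ} {a b : Elem σ} (h : NEquiv n a b) :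
    a.parenthoodPred = b.parenthoodPred :=
  h.mono n.zero_le

theorem NEquiv.arg {n : ℕ} {a b : Elem σ} (h : NEquiv (n + 1) a b) (k : ℕ) :
    NEquiv n (a.arg k) (b.arg k) := by
  have hp := h.2.1
  unfold Elem.arg
  by_cases hk : k = 0
  · simpa [hk] using h.2.2.1
  · by_cases hk' : k - 1 < σ.arity a.parenthoodPred - 1
    · rw [if_neg hk, if_neg hk, dif_pos hk', dif_pos (hp ▸ hk')]
      exact h.2.2.2 _ _ rfl
    · rw [if_neg hk, if_neg hk, dif_neg hk', dif_neg (hp ▸ hk')]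
      exact h.2.2.1

/-! ### Limits of sequences of elements -/

open Filter

/-- Two sequences of elements have the same limit if, for each `m`, almost all of their members
are `m`-equivalent. -/
def limitSetoid (σ : Signature) : Setoid (ℕ → Elem σ) where
  r s t := ∀ m, ∀ᶠ n in (hyperfilter ℕ : Filter ℕ), NEquiv m (s n) (t n)
  iseqv :=
    ⟨fun _ m => .of_forall fun _ => (nEquiv_equivalence m).refl _,
      fun h m => (h m).mono fun _ => (nEquiv_equivalence m).symm,
      fun h h' m => (h m).mp ((h' m).mono fun _ h' h => (nEquiv_equivalence m).trans h h')⟩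

/-- Limits of sequences of elements. -/
abbrev Limit (σ : Signature) : Type := Quotient (limitSetoid σ)

/-- The limit of a sequence. -/
abbrev seqLim (s : ℕ → Elem σ) : Limit σ := Quotient.mk (limitSetoid σ) s

/-- An ultrafilter selects one of finitely many predicates; 0-equivalence makes it independent of
the representative. -/
theorem exists_limit_pred [Finite σ.Pred] (z : Limit σ) : ∃ Q : σ.Pred, ∀ s, seqLim s = z →
    ∀ᶠ n in (hyperfilter ℕ : Filter ℕ), (s n).parenthoodPred = Q := by
  induction z using Quotient.inductionOn with
  | h t =>
    have h : (⋃ Q ∈ (Set.univ : Set σ.Pred), {n | (t n).parenthoodPred = Q}) ∈ hyperfilter ℕ := by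
      have : (⋃ Q ∈ (Set.univ : Set σ.Pred), {n | (t n).parenthoodPred = Q}) = Set.univ := by
        ext; simp
      rw [this]
      exact Filter.univ_mem
    obtain ⟨Q, -, hQ⟩ := (Ultrafilter.finite_biUnion_mem_iff Set.finite_univ).1 h
    refine ⟨Q, fun s hs => ?_⟩
    filter_upwards [hQ, Quotient.exact hs 0] with n h1 h2
    exact h2.parenthoodPred_eq.trans h1

/-- The predicate of almost all Parenthood Atoms of a sequence with the given limit. -/
noncomputable def limitPred [Finite σ.Pred] (z : Limit σ) : σ.Pred := (exists_limit_pred z).choose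

theorem limitPred_spec [Finite σ.Pred] (s : ℕ → Elem σ) :
    ∀ᶠ n in (hyperfilter ℕ : Filter ℕ), (s n).parenthoodPred = limitPred (seqLim s) :=
  (exists_limit_pred (seqLim s)).choose_spec s rfl

/-- The limit of the arguments at position `k` of the Parenthood Atoms. -/
def limitArg (k : ℕ) : Limit σ → Limit σ :=
  -- Taking an argument costs one level of equivalence, which is harmless since all levels are
  -- controlled.
  Quotient.map (fun s n => (s n).arg k) fun _ _ h m => (h (m + 1)).mono fun _ h => h.arg k

/-- Parents in the limit. -/
def LimitParent [Finite σ.Pred] (y z : Limit σ) : Prop :=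
  ∃ k, 0 < k ∧ k < σ.arity (limitPred z) ∧ limitArg k z = y

/-- The bound `k` depends on the path alone, not on the representative or on `n`, so a single
coloring can exclude a cycle. -/
theorem LimitParent.exists_history [Finite σ.Pred] {y z : Limit σ}
    (h : Relation.TransGen LimitParent y z) : ∃ k, ∀ s, seqLim s = z → ∃ t, seqLim t = y ∧
      ∀ᶠ n in (hyperfilter ℕ : Filter ℕ),
        t n ∈ history (k + 1) (s n) ∧ Relation.TransGen IsParent (t n) (s n) := by
  have step : ∀ {c z : Limit σ}, LimitParent c z → ∀ s, seqLim s = z → ∃ t, seqLim t = c ∧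
      ∀ᶠ n in (hyperfilter ℕ : Filter ℕ), IsParent (t n) (s n) := by
    rintro c z ⟨k, h0, hk, rfl⟩ s rfl
    refine ⟨fun n => (s n).arg k, rfl, ?_⟩
    filter_upwards [limitPred_spec s] with n hn
    exact (s n).isParent_arg h0 (hn ▸ hk)
  induction h with
  | single h =>
    refine ⟨0, fun s hs => ?_⟩
    obtain ⟨t, ht, h⟩ := step h s hs
    exact ⟨t, ht, h.mono fun n hn => ⟨hn, .single hn⟩⟩
  | tail _ h ih =>
    obtain ⟨k, ih⟩ := ih
    refine ⟨k + 1, fun s hs => ?_⟩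
    obtain ⟨u, hu, h⟩ := step h s hs
    obtain ⟨t, ht, h'⟩ := ih u hu
    refine ⟨t, ht, ?_⟩
    filter_upwards [h, h'] with n hn hn'
    refine ⟨Or.inr ?_, hn'.2.tail hn⟩
    simp only [Set.mem_iUnion]
    exact ⟨u n, hn, hn'.1⟩

/-- There are no cycles of parents in the limit, because of the colorings. -/
theorem LimitParent.irrefl [Finite σ.Pred] (z : Limit σ) :
    ¬ Relation.TransGen LimitParent z z := by
  intro h
  obtain ⟨k, hk⟩ := exists_history h
  obtain ⟨s, rfl⟩ := Quotient.exists_rep z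
  obtain ⟨t, ht, h⟩ := hk s rfl
  -- Both sequences represent `z`, so at some index the proper ancestor `t n` of `s n` is also
  -- (k+1)-equivalent to it and shares its (k+1)-color.
  obtain ⟨n, ⟨h1, h2⟩, h3⟩ := (h.and (Quotient.exact ht (k + 1))).exists
  have hne : t n ≠ s n := fun he =>
    (isParent_wf.transGen.irrefl.irrefl (s n)) (he ▸ h2)
  exact color_ne h1 hne h3.color_eq

/-! ### From limits back to the chase -/

/-- In limits of true atoms, ancestors are parents. -/
theorem limitArg_addr [Finite σ.Pred] (hF : RespectsFamilyPatterns T) {Q : σ.Pred}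
    (b : ℕ → Fin (σ.arity Q) → Elem σ)
    (hb : ∀ᶠ n in (hyperfilter ℕ : Filter ℕ), ⟨Q, b n⟩ ∈ chaseFacts T)
    {i j : Fin (σ.arity Q)} (h : (σ.pattern Q).lt j i) :
    limitArg ((σ.pattern Q).addr i j).val (seqLim fun n => b n i) = seqLim (fun n => b n j) ∧
      0 < ((σ.pattern Q).addr i j).val ∧
      ((σ.pattern Q).addr i j).val < σ.arity (limitPred (seqLim fun n => b n i)) := by
  have key : ∀ᶠ n in (hyperfilter ℕ : Filter ℕ),
      b n j = (b n i).arg ((σ.pattern Q).addr i j).val ∧ 0 < ((σ.pattern Q).addr i j).val ∧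
      ((σ.pattern Q).addr i j).val < σ.arity (b n i).parenthoodPred := by
    filter_upwards [hb] with n hn
    obtain ⟨m, hm⟩ := Set.mem_iUnion.1 hn
    exact args_eq_arg_addr hF m _ hm j i h
  refine ⟨Quotient.sound fun m => ?_, ?_⟩
  · filter_upwards [key] with n hn
    rw [hn.1]
    exact (nEquiv_equivalence m).refl _
  · obtain ⟨n, hn, hn'⟩ := (key.and (limitPred_spec fun n => b n i)).exists
    exact ⟨hn.2.1, hn' ▸ hn.2.2⟩

/-- Some arguments of the limit of true atoms can be realized by elements of the chase. -/
theorem exists_fact_of_limit [Finite σ.Pred] (hJ : ∀ τ ∈ T, τ.Joinless)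
    (hF : RespectsFamilyPatterns T) {Q : σ.Pred} (b : ℕ → Fin (σ.arity Q) → Elem σ)
    (hb : ∀ᶠ n in (hyperfilter ℕ : Filter ℕ), ⟨Q, b n⟩ ∈ chaseFacts T)
    (I : Set (Fin (σ.arity Q))) (c : Fin (σ.arity Q) → Elem σ)
    (hc : ∀ i ∈ I, (c i).parenthoodAtom ∈ chaseFacts T ∧
      (c i).parenthoodPred = limitPred (seqLim fun n => b n i))
    (hlt : ∀ j ∈ I, ∀ i ∈ I, (σ.pattern Q).lt j i →
      c j = (c i).arg ((σ.pattern Q).addr i j).val) :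
    ∃ B : Fin (σ.arity Q) → Elem σ, ⟨Q, B⟩ ∈ chaseFacts T ∧ ∀ i ∈ I, B i = c i := by
  have hp : ∀ᶠ n in (hyperfilter ℕ : Filter ℕ),
      ∀ i, (b n i).parenthoodPred = limitPred (seqLim fun n => b n i) :=
    eventually_all.2 fun i => limitPred_spec fun n => b n i
  obtain ⟨n, hn, hn'⟩ := (hb.and hp).exists
  obtain ⟨m, hm⟩ := Set.mem_iUnion.1 hn
  exact exists_fact_with_args hJ hF m _ hm I c
    (fun i hi => ⟨(hc i hi).1, (hc i hi).2.trans (hn' i).symm⟩) hlt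

/-- A finite set of limits of sequences of elements of the chase can be mapped to the chase. -/
theorem exists_map_of_limit [Finite σ.Pred] (hJ : ∀ τ ∈ T, τ.Joinless)
    (hF : RespectsFamilyPatterns T) (V : Set (Limit σ)) [Finite V]
    (hV : ∀ z ∈ V, ∃ s, seqLim s = z ∧ ∀ n, s n ∈ chaseDom T) :
    ∃ h : V → Elem σ, ∀ z : V, (h z).parenthoodAtom ∈ chaseFacts T ∧
      (h z).parenthoodPred = limitPred z.1 ∧
      ∀ k, 0 < k → k < σ.arity (limitPred z.1) → ∀ y : V, limitArg k z.1 = y.1 →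
        h y = (h z).arg k := by
  classical
  let r : V → V → Prop := fun y z => Relation.TransGen LimitParent y.1 z.1
  have : IsTrans V r := ⟨fun _ _ _ => Relation.TransGen.trans⟩
  have : Std.Irrefl r := ⟨fun z => LimitParent.irrefl z.1⟩
  have wf : WellFounded r := Finite.wellFounded_of_trans_of_irrefl r
  have hr : ∀ {y z : V} {k : ℕ}, 0 < k → k < σ.arity (limitPred z.1) → limitArg k z.1 = y.1 →
      r y z := fun h0 hk h => .single ⟨_, h0, hk, h⟩
  by_cases hne : Nonempty (Elem σ)
  swap
  · refine ⟨fun z => absurd ⟨(hV z.1 z.2).choose 0⟩ hne, fun z =>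
      absurd ⟨(hV z.1 z.2).choose 0⟩ hne⟩
  let good : (z : V) → ((y : V) → r y z → Elem σ) → Elem σ → Prop := fun z h a =>
    a.parenthoodAtom ∈ chaseFacts T ∧ a.parenthoodPred = limitPred z.1 ∧
      ∀ k (h0 : 0 < k) (hk : k < σ.arity (limitPred z.1)) (y : V) (hy : limitArg k z.1 = y.1),
        h y (hr h0 hk hy) = a.arg k
  -- Existence of a good value depends on the earlier values being good, so the recursion chooses
  -- blindly and the induction below justifies the choices.
  let h : V → Elem σ := wf.fix fun z rec => Classical.epsilon (good z rec)
  have hfix : ∀ z, h z = Classical.epsilon (good z fun y _ => h y) := fun z => wf.fix_eq _ z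
  refine ⟨h, fun z => ?_⟩
  induction z using wf.induction with
  | _ z ih =>
    suffices hex : ∃ a, good z (fun y _ => h y) a by
      have := Classical.epsilon_spec hex
      rw [← hfix z] at this
      exact this
    obtain ⟨s, hs, hs'⟩ := hV z.1 z.2
    set Q := limitPred z.1 with hQ
    have hpred := limitPred_spec s
    rw [hs, ← hQ] at hpred
    have hatom : ∀ n, (s n).parenthoodAtom ∈ chaseFacts T ∧ σ.IsParenthood (s n).parenthoodPred :=
      fun n =>
        let h := (parenthoodAtom_unique hF (s n) (hs' n) _).2 rfl
        ⟨h.1, h.2.1⟩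
    have hpar : σ.IsParenthood Q := by
      obtain ⟨n, hn⟩ := hpred.exists
      exact hn ▸ (hatom n).2
    have hb : ∀ᶠ n in (hyperfilter ℕ : Filter ℕ),
        (⟨Q, fun p => (s n).arg p.val⟩ : Atom σ (Elem σ)) ∈ chaseFacts T := by
      filter_upwards [hpred] with n hn
      rw [← Elem.parenthoodAtom_eq _ hn]
      exact (hatom n).1
    have hlim : ∀ k, (seqLim fun n => (s n).arg k) = limitArg k z.1 := fun k => by rw [← hs]; rfl
    let c : Fin (σ.arity Q) → Elem σ := fun i =>
      if hi : limitArg i.val z.1 ∈ V then h ⟨_, hi⟩ else s 0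
    -- Only parents in `V` are prescribed; position 0 is left for the element to be found, and the
    -- value `s 0` outside `V` is never used.
    let I : Set (Fin (σ.arity Q)) := {i | 0 < i.val ∧ limitArg i.val z.1 ∈ V}
    have hcI : ∀ i (hi : i ∈ I), c i = h ⟨_, hi.2⟩ := fun i hi => dif_pos hi.2
    obtain ⟨B, hB, hBI⟩ := exists_fact_of_limit hJ hF _ hb I c (by
      intro i hi
      have := ih ⟨_, hi.2⟩ (hr hi.1 i.isLt rfl)
      rw [hcI i hi, hlim]
      exact ⟨this.1, this.2.1⟩) (by
      intro j hj i hi hlt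
      obtain ⟨h1, h2, h3⟩ := limitArg_addr hF _ hb hlt
      rw [hlim, hlim] at h1
      rw [hlim] at h3
      rw [hcI i hi, hcI j hj]
      exact (ih ⟨_, hi.2⟩ (hr hi.1 i.isLt rfl)).2.2 _ h2 h3 ⟨_, hj.2⟩ h1)
    obtain ⟨m, hm⟩ := Set.mem_iUnion.1 hB
    -- A true atom of a parenthood predicate is the Parenthood Atom of its first argument, which
    -- becomes the image of `z`.
    obtain ⟨a, ha⟩ := (stage_spec hF m _ hm).1 hpar
    have hap : a.parenthoodPred = Q := (congrArg Atom.pred ha).symm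
    have hBa : B = fun p => a.arg p.val := by
      rw [Elem.parenthoodAtom_eq a hap] at ha
      simpa using ha
    refine ⟨a, ha ▸ hB, hap, fun k h0 hk y hy => ?_⟩
    have hkI : (⟨k, hk⟩ : Fin (σ.arity Q)) ∈ I := ⟨h0, by simp [hy]⟩
    have h1 := hBI _ hkI
    rw [hcI _ hkI, hBa] at h1
    exact (congrArg h (Subtype.ext hy.symm)).trans h1.symm

/-! ### Satisfying the query in the chase -/

theorem theorem3 (σ : Signature) [Finite σ.Pred] (T : Set (TGD σ))
    (hJoinless : ∀ τ ∈ T, τ.Joinless) (hFamily : RespectsFamilyPatterns T)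
    (φ : CQ σ) (hφ : MTrue T φ) : (chase T).Models φ := by
  choose v hv using hφ
  let s : Fin φ.numVars → ℕ → Elem σ := fun x n => (v n x).out.val
  have hs : ∀ x n, s x n ∈ chaseDom T := fun x n => (v n x).out.2
  let q : Fin φ.numVars → Limit σ := fun x => seqLim (s x)
  obtain ⟨h, hh⟩ := exists_map_of_limit hJoinless hFamily (Set.range q) (by
    rintro _ ⟨x, rfl⟩
    exact ⟨s x, rfl, hs x⟩)
  let g : Fin φ.numVars → Elem σ := fun x => h ⟨q x, x, rfl⟩
  have hg : ∀ A ∈ φ.atoms, A.map g ∈ chaseFacts T := by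
    rintro ⟨Q, x⟩ hA
    -- Arguments of the true atom behind `A` in `M_n` need only be n-equivalent to the chosen
    -- representatives, and may vary between occurrences of a variable.
    have hex : ∀ n, ∃ b : Fin (σ.arity Q) → Elem σ, ⟨Q, b⟩ ∈ chaseFacts T ∧
        ∀ p, NEquiv n (b p) (s (x p) n) := by
      intro n
      obtain ⟨⟨Q', b⟩, hb, he⟩ := hv n _ hA
      obtain rfl : Q' = Q := congrArg Atom.pred he
      refine ⟨fun p => (b p).val, hb, fun p => ?_⟩
      have he' : (fun p => Quotient.mk (nSetoid T n) (b p)) = fun p => v n (x p) := by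
        exact eq_of_heq (Atom.mk.inj he).2
      have := (congrFun he' p).trans (Quotient.out_eq (v n (x p))).symm
      exact Quotient.exact this
    choose b hb hbs using hex
    have hlim : ∀ p, (seqLim fun n => b n p) = q (x p) := fun p => Quotient.sound fun m => by
      have : ∀ᶠ n in (hyperfilter ℕ : Filter ℕ), m ≤ n :=
        Nat.hyperfilter_le_atTop (eventually_ge_atTop m)
      filter_upwards [this] with n hn
      exact (hbs n p).mono hn
    have hb' : ∀ᶠ n in (hyperfilter ℕ : Filter ℕ), ⟨Q, b n⟩ ∈ chaseFacts T := .of_forall hb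
    -- With all positions prescribed, the fact obtained is the instance of the atom under `g`.
    obtain ⟨B, hB, hBx⟩ := exists_fact_of_limit hJoinless hFamily b hb' Set.univ
      (fun p => g (x p)) (by
        intro i _
        rw [hlim]
        exact ⟨(hh _).1, (hh _).2.1⟩) (by
        intro j _ i _ hlt
        obtain ⟨h1, h2, h3⟩ := limitArg_addr hFamily b hb' hlt
        rw [hlim, hlim] at h1
        rw [hlim] at h3
        exact (hh _).2.2 _ h2 h3 _ h1)
    have : B = fun p => g (x p) := funext fun p => hBx p trivial
    rwa [this] at hB
  have hgdom : ∀ x, g x ∈ chaseDom T := by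
    intro x
    have hfact := (hh ⟨q x, x, rfl⟩).1
    obtain ⟨m, hm⟩ := Set.mem_iUnion.1 hfact
    -- The predicate of `g x` is that of some chase element, so it has a first position, where `g x`
    -- occurs.
    have hpos : 0 < σ.arity (g x).parenthoodPred := by
      obtain ⟨n, hn⟩ := (limitPred_spec (s x)).exists
      obtain ⟨-, -, p, -⟩ := (parenthoodAtom_unique hFamily _ (hs x n) _).2 rfl
      have := p.pos
      change 0 < σ.arity (s x n).parenthoodPred at this
      have he : (g x).parenthoodPred = limitPred (seqLim (s x)) := (hh ⟨q x, x, rfl⟩).2.1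
      rwa [he, ← hn]
    exact ⟨_, hfact, ⟨0, hpos⟩, by simp [Elem.parenthoodAtom, g]⟩
  exact ⟨fun x => ⟨g x, hgdom x⟩, fun A hA => hg A hA⟩
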